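/- Let $\Omega\subset\mathbb R^n$ be a nonempty bounded open set and let $L: M^{n,n}(\mathbb R)\to\mathbb R$ be a $C^2$ function on the space of real $n\times n$ matrices. For a map $u$ put $I(u;\Omega)=\int_\Omega L(\nabla u(x))\,dx$, where $(\nabla u)_{ij}=\partial u_i/\partial x_j$. Let $\mathrm{Diff}_0^\infty(\Omega)$ be the group of $C^\infty$ diffeomorphisms $\phi$ of $\mathbb R^n$ (with $C^\infty$ inverse) such that the support of $\phi-\mathrm{id}$ is a compact subset of $\Omega$. Then the following statements are equivalent: (i) $I(\cdot;\Omega)$ is $\mathrm{Diff}_0^\infty(\Omega)$ invariant under inner variations: for every $u\in C^3(\Omega,\mathbb R^n)$ for which $I(u;\Omega)$ is defined (that is, $L(\nabla u)\in L^1(\Omega)$) and every $\phi\in\mathrm{Diff}_0^\infty(\Omega)$, $I(u\circ\phi;\Omega)$ is defined as well and $I(u\circ\phi;\Omega)=I(u;\Omega)$; (ii) $L$ is a null Lagrangian: for every bounded open set $U\subset\mathbb R^n$, every $u\in C^\infty(\mathbb R^n,\mathbb R^n)$ and every $\eta\in C^\infty(\mathbb R^n,\mathbb R^n)$ whose support is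 a compact subset of $U$, $$\int_U L(\nabla u+\nabla\eta)\,dx=\int_U L(\nabla u)\,dx .$$ -/

import Mathlib

open MeasureTheory
open scoped ContDiff

-- The space of real `n × n` matrices is normed entrywise (it is finite dimensional, so the choice
-- of the norm does not affect which functions on it are of class `C^2`).
attribute [local instance] Matrix.normedAddCommGroup Matrix.normedSpace

noncomputable section

namespace NullLagrangian

/-- The gradient matrix `(∇u)(x)`, with entries `(∇u)ᵢⱼ = ∂uᵢ/∂xⱼ`. -/
def grad {n : ℕ} (u : EuclideanSpace ℝ (Fin n) → EuclideanSpace ℝ (Fin n))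
    (x : EuclideanSpace ℝ (Fin n)) : Matrix (Fin n) (Fin n) ℝ :=
  Matrix.of fun i j => fderiv ℝ u x (EuclideanSpace.single j 1) i

/-- The functional `I(u; Ω) = ∫_Ω L(∇u(x)) dx`. -/
def energy {n : ℕ} (L : Matrix (Fin n) (Fin n) ℝ → ℝ)
    (u : EuclideanSpace ℝ (Fin n) → EuclideanSpace ℝ (Fin n))
    (Ω : Set (EuclideanSpace ℝ (Fin n))) : ℝ :=
  ∫ x in Ω, L (grad u x)

/-- `Diff_0^∞(Ω)`: the smooth diffeomorphisms `φ` of `ℝⁿ` (with smooth inverse) for which the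
support of `φ - id` is a compact subset of `Ω`. -/
def Diff0 {n : ℕ} (Ω : Set (EuclideanSpace ℝ (Fin n))) :
    Set (EuclideanSpace ℝ (Fin n) → EuclideanSpace ℝ (Fin n)) :=
  {φ | ContDiff ℝ ∞ φ ∧
    (∃ ψ : EuclideanSpace ℝ (Fin n) → EuclideanSpace ℝ (Fin n),
      ContDiff ℝ ∞ ψ ∧ Function.LeftInverse ψ φ ∧ Function.RightInverse ψ φ) ∧
    HasCompactSupport (fun x => φ x - x) ∧ tsupport (fun x => φ x - x) ⊆ Ω}

/-- `I(·; Ω)` is `Diff_0^∞(Ω)` invariant (under inner variations): `I(u ∘ φ; Ω) = I(u; Ω)` for all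
`φ ∈ Diff_0^∞(Ω)` and all `u ∈ C^3(Ω, ℝⁿ)` at which `I(·; Ω)` is defined, that is, for which
`L(∇u)` is integrable over `Ω`; that `I(u ∘ φ; Ω)` is defined as well is part of the claim.
Only the values of `u` on `Ω` matter, because `φ` maps the open set `Ω` onto itself. -/
def IsInnerInvariant {n : ℕ} (L : Matrix (Fin n) (Fin n) ℝ → ℝ)
    (Ω : Set (EuclideanSpace ℝ (Fin n))) : Prop :=
  ∀ u : EuclideanSpace ℝ (Fin n) → EuclideanSpace ℝ (Fin n), ContDiffOn ℝ 3 u Ω →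
    IntegrableOn (fun x => L (grad u x)) Ω →
    ∀ φ ∈ Diff0 Ω,
      IntegrableOn (fun x => L (grad (u ∘ φ) x)) Ω ∧ energy L (u ∘ φ) Ω = energy L u Ω

/-- `L` is a (classical, homogeneous) null Lagrangian: on every bounded open set `U`, the integral
`∫_U L(∇u)` does not change when a smooth map with compact support in `U` is added to the smooth
map `u`. (All integrands are continuous on `ℝⁿ`, hence integrable over `U`, if `L` is
continuous.) -/
def IsNullLagrangian {n : ℕ} (L : Matrix (Fin n) (Fin n) ℝ → ℝ) : Prop :=
  ∀ U : Set (EuclideanSpace ℝ (Fin n)), IsOpen U → Bornology.IsBounded U →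
    ∀ u η : EuclideanSpace ℝ (Fin n) → EuclideanSpace ℝ (Fin n),
      ContDiff ℝ ∞ u → ContDiff ℝ ∞ η → HasCompactSupport η → tsupport η ⊆ U →
      energy L (u + η) U = energy L u U

end NullLagrangian

end

/-!
Both properties are equivalent to a pointwise condition on the Hessian of `L`, called `RankOneFlat`
below: `D²L(A)(l ⊗ a, l ⊗ a) = 0` for all `A`, `a`, `l`.

Necessity. Suppose that `∫_Ω L(A + t∇η)` does not depend on small `t`, for each test map `η`.
Then the second variation `∫_Ω D²L(A)(∇η, ∇η)` vanishes. Inserting `χ a`, `(χ cos l) a` and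
`(χ sin l) a` with a bump function `χ`, all terms but `D²L(A)(l ⊗ a, l ⊗ a) ∫ χ²` cancel
(`quadratic_smulRight_eq_zero_of_integral_eq_zero`). For a null Lagrangian the supposition holds at
every `A` by definition. For an inner invariant functional it holds at every invertible `A`, since
`A + tη = A ∘ (id + t A⁻¹η)` and `id + t A⁻¹η` is a diffeomorphism for small `t`; the invertible
matrices are dense and `D²L` is continuous.

Sufficiency. By polarization, rank-one flatness makes `D²L(A)(l ⊗ a, m ⊗ b)` antisymmetric in `l`
and `m`, so its contraction with the symmetric second derivatives of a map `w` is zero. That is, the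
field `DL(∇w)` has zero divergence for every `C²` map `w`, and integration by parts gives
`d/dt ∫ L(∇u + t∇η) = 0` for all `t` (`RankOneFlat.setIntegral_add_eq`). This is the null Lagrangian
property, and it also applies to `η = u ∘ φ - u`, which has compact support in `Ω`.

The argument is carried out for functions of the Fréchet derivative on a finite-dimensional
space with a Haar measure; matrices enter only at the end, through `matrixCLM`.
-/

namespace NullLagrangian

open Filter Topology Set

section Hessian

/-! ### Rank-one flat Hessians -/

variable {E F : Type*} [NormedAddCommGroup E] [NormedSpace ℝ E]
  [NormedAddCommGroup F] [NormedSpace ℝ F]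

/-- The second derivative of `G` vanishes on the diagonal in every rank-one direction `l ⊗ a`, the
map `x ↦ l(x) a`: for `G` of class `C²` this says that `G` is affine along rank-one lines. -/
def RankOneFlat (G : (E →L[ℝ] F) → ℝ) : Prop :=
  ∀ (A : E →L[ℝ] F) (l : E →L[ℝ] ℝ) (a : F),
    fderiv ℝ (fderiv ℝ G) A (l.smulRight a) (l.smulRight a) = 0

theorem fderiv_fderiv_comm {G : (E →L[ℝ] F) → ℝ} (hG : ContDiff ℝ 2 G) (A X Y : E →L[ℝ] F) :
    fderiv ℝ (fderiv ℝ G) A X Y = fderiv ℝ (fderiv ℝ G) A Y X :=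
  (hG.contDiffAt.isSymmSndFDerivAt (by simp)).eq X Y

/-- Polarization of rank-one flatness in the vector and then in the covector: the Hessian is
antisymmetric under exchange of the two covectors. -/
theorem RankOneFlat.smulRight_antisymm {G : (E →L[ℝ] F) → ℝ} (hR : RankOneFlat G)
    (hG : ContDiff ℝ 2 G) (A : E →L[ℝ] F) (l m : E →L[ℝ] ℝ) (a b : F) :
    fderiv ℝ (fderiv ℝ G) A (l.smulRight a) (m.smulRight b) =
      -fderiv ℝ (fderiv ℝ G) A (m.smulRight a) (l.smulRight b) := by
  have key : ∀ (l : E →L[ℝ] ℝ) (a b : F),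
      fderiv ℝ (fderiv ℝ G) A (l.smulRight a) (l.smulRight b) = 0 := by
    intro l a b
    have h := hR A l (a + b)
    have e : l.smulRight (a + b) = l.smulRight a + l.smulRight b := by ext; simp
    rw [e] at h
    simp only [map_add, add_apply, hR A l a, hR A l b] at h
    rw [fderiv_fderiv_comm hG A (l.smulRight b) (l.smulRight a)] at h
    linarith
  have h := key (l + m) a b
  have e : ∀ a : F, (l + m).smulRight a = l.smulRight a + m.smulRight a := by
    intro a; ext; simp [add_smul]
  simp only [e, map_add, add_apply, key l a b, key m a b] at h
  linarith

/-- The Hessian of a `C²` function is continuous, so rank-one flatness need only be checked at a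
dense set of base points. -/
theorem RankOneFlat.of_dense {G : (E →L[ℝ] F) → ℝ} (hG : ContDiff ℝ 2 G)
    {S : Set (E →L[ℝ] F)} (hS : Dense S) (h : ∀ A ∈ S, ∀ (l : E →L[ℝ] ℝ) (a : F),
      fderiv ℝ (fderiv ℝ G) A (l.smulRight a) (l.smulRight a) = 0) : RankOneFlat G := by
  intro A l a
  have hD2G : Continuous (fderiv ℝ (fderiv ℝ G)) :=
    (hG.fderiv_right (m := 1) (by norm_num)).continuous_fderiv (by norm_num)
  have hcont : Continuous fun A => fderiv ℝ (fderiv ℝ G) A (l.smulRight a) (l.smulRight a) := by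
    fun_prop
  exact congrFun (hcont.ext_on hS continuous_const fun A hA => h A hA l a) A

variable [FiniteDimensional ℝ E]

theorem eq_sum_coord_smulRight {ι : Type*} [Fintype ι] (b : Module.Basis ι ℝ E) (A : E →L[ℝ] F) :
    A = ∑ i, (b.coord i).toContinuousLinearMap.smulRight (A (b i)) := by
  ext x
  have h := congrArg A (b.sum_repr x)
  rw [map_sum] at h
  simpa using h.symm

/-- The algebraic form of the Euler-Lagrange equation: if `W` is a symmetric second derivative, the
sum over `i` of `D²G(A)(W eᵢ, eⁱ ⊗ a)` is zero, because it pairs the symmetric `W` with an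
expression antisymmetric in the two covectors. -/
theorem RankOneFlat.sum_fderiv_fderiv_eq_zero {G : (E →L[ℝ] F) → ℝ} (hR : RankOneFlat G)
    (hG : ContDiff ℝ 2 G) {ι : Type*} [Fintype ι] (b : Module.Basis ι ℝ E) (A : E →L[ℝ] F)
    {W : E →L[ℝ] E →L[ℝ] F} (hW : ∀ x y, W x y = W y x) (a : F) :
    ∑ i, fderiv ℝ (fderiv ℝ G) A (W (b i)) ((b.coord i).toContinuousLinearMap.smulRight a) = 0 := by
  set c : ι → E →L[ℝ] ℝ := fun i => (b.coord i).toContinuousLinearMap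
  have h : ∀ i, fderiv ℝ (fderiv ℝ G) A (W (b i)) ((c i).smulRight a) =
      ∑ k, fderiv ℝ (fderiv ℝ G) A ((c k).smulRight (W (b i) (b k))) ((c i).smulRight a) := by
    intro i
    conv_lhs => rw [eq_sum_coord_smulRight b (W (b i))]
    simp [map_sum, c]
  change ∑ i, fderiv ℝ (fderiv ℝ G) A (W (b i)) ((c i).smulRight a) = 0
  -- expand `W (b i)` in rank-one maps and exchange the roles of the two indices
  have h2 : ∑ i, fderiv ℝ (fderiv ℝ G) A (W (b i)) ((c i).smulRight a) =
      -∑ i, fderiv ℝ (fderiv ℝ G) A (W (b i)) ((c i).smulRight a) := by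
    conv_lhs => simp only [h]
    conv_rhs => simp only [h]
    conv_lhs => rw [Finset.sum_comm]
    rw [← Finset.sum_neg_distrib]
    refine Finset.sum_congr rfl fun k _ => ?_
    rw [← Finset.sum_neg_distrib]
    refine Finset.sum_congr rfl fun i _ => ?_
    rw [hR.smulRight_antisymm hG, hW]
  linarith

end Hessian

section Integral

/-! ### Differentiation under the integral sign -/

variable {E F : Type*} [NormedAddCommGroup E] [NormedSpace ℝ E] [FiniteDimensional ℝ E]
  [MeasurableSpace E] [BorelSpace E] [NormedAddCommGroup F] [NormedSpace ℝ F]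

theorem integrableOn_of_continuous_of_isBounded {f : E → ℝ} (hf : Continuous f) {U : Set E}
    (hU : Bornology.IsBounded U) (μ : Measure E) [IsFiniteMeasureOnCompacts μ] :
    IntegrableOn f U μ :=
  have := FiniteDimensional.proper ℝ E
  (hf.continuousOn.integrableOn_compact hU.isCompact_closure).mono_set subset_closure

theorem hasDerivAt_setIntegral_of_continuous {f f' : ℝ → E → ℝ}
    (hf : ∀ t, Continuous (f t)) (hf' : Continuous fun p : ℝ × E => f' p.1 p.2)
    (hd : ∀ t x, HasDerivAt (fun s => f s x) (f' t x) t) {U : Set E} (hUm : MeasurableSet U)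
    (hU : Bornology.IsBounded U) (μ : Measure E) [IsFiniteMeasureOnCompacts μ] (t : ℝ) :
    HasDerivAt (fun s => ∫ x in U, f s x ∂μ) (∫ x in U, f' t x ∂μ) t := by
  have := FiniteDimensional.proper ℝ E
  obtain ⟨C, hC⟩ := ((isCompact_closedBall t (1 : ℝ)).prod
    hU.isCompact_closure).exists_bound_of_continuousOn hf'.continuousOn
  have hf't : Continuous (f' t) := hf'.comp (by fun_prop : Continuous fun x : E => (t, x))
  refine (hasDerivAt_integral_of_dominated_loc_of_deriv_le (bound := fun _ => C)
    (Metric.closedBall_mem_nhds t one_pos)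
    (Eventually.of_forall fun s => (hf s).aestronglyMeasurable)
    (integrableOn_of_continuous_of_isBounded (hf t) hU μ) hf't.aestronglyMeasurable ?_
    (integrableOn_of_continuous_of_isBounded continuous_const hU μ)
    (Eventually.of_forall fun x s _ => hd s x)).2
  filter_upwards [ae_restrict_mem hUm] with x hx s hs
  exact hC (s, x) ⟨hs, subset_closure hx⟩

theorem hasDerivAt_setIntegral_line {G : (E →L[ℝ] F) → ℝ} (hG : ContDiff ℝ 1 G)
    {P Q : E → E →L[ℝ] F} (hP : Continuous P) (hQ : Continuous Q) {U : Set E}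
    (hUm : MeasurableSet U) (hU : Bornology.IsBounded U) (μ : Measure E)
    [IsFiniteMeasureOnCompacts μ] (t : ℝ) :
    HasDerivAt (fun s => ∫ x in U, G (P x + s • Q x) ∂μ)
      (∫ x in U, fderiv ℝ G (P x + t • Q x) (Q x) ∂μ) t := by
  have hDG : Continuous (fderiv ℝ G) := hG.continuous_fderiv (by norm_num)
  refine hasDerivAt_setIntegral_of_continuous (f := fun s x => G (P x + s • Q x))
    (f' := fun s x => fderiv ℝ G (P x + s • Q x) (Q x)) (fun s => ?_) ?_ (fun s x => ?_) hUm hU μ t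
  · exact hG.continuous.comp (by fun_prop)
  · exact (hDG.comp (by fun_prop)).clm_apply (by fun_prop)
  · have h1 : HasDerivAt (fun s : ℝ => P x + s • Q x) (Q x) s := by
      simpa using ((hasDerivAt_id s).smul_const (Q x)).const_add (P x)
    exact ((hG.differentiable (by norm_num)) _).hasFDerivAt.comp_hasDerivAt s h1

/-! ### Vanishing of the first variation of rank-one flat functions -/

/-- The Euler-Lagrange equation of a rank-one flat `G` holds weakly at every `C²` map `w`: moving
the derivative off `η` produces the divergence of `DG(∇w)`, which vanishes identically. -/
theorem RankOneFlat.integral_fderiv_eq_zero {G : (E →L[ℝ] F) → ℝ} (hR : RankOneFlat G)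
    (hG : ContDiff ℝ 2 G) {w η : E → F} (hw : ContDiff ℝ 2 w) (hη : ContDiff ℝ 1 η)
    (hηc : HasCompactSupport η) (μ : Measure E) [μ.IsAddHaarMeasure] :
    ∫ x, fderiv ℝ G (fderiv ℝ w x) (fderiv ℝ η x) ∂μ = 0 := by
  let b := Module.finBasis ℝ E
  let c : Fin (Module.finrank ℝ E) → E →L[ℝ] ℝ := fun i => (b.coord i).toContinuousLinearMap
  let T : Fin (Module.finrank ℝ E) → F →L[ℝ] (E →L[ℝ] F) :=
    fun i => ContinuousLinearMap.smulRightL ℝ E F (c i)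
  have hT : ∀ i a, T i a = (c i).smulRight a := fun i a => rfl
  have hDw : ContDiff ℝ 1 (fderiv ℝ w) := hw.fderiv_right (by norm_num)
  have hDG : ContDiff ℝ 1 (fderiv ℝ G) := hG.fderiv_right (by norm_num)
  have hDη : Continuous (fderiv ℝ η) := hη.continuous_fderiv (by norm_num)
  -- `f i` is the `i`-th column of the momentum field `DG(∇w)`
  let f : Fin (Module.finrank ℝ E) → E → (F →L[ℝ] ℝ) :=
    fun i x => (fderiv ℝ G (fderiv ℝ w x)).comp (T i)
  have hf : ∀ i, ContDiff ℝ 1 (f i) := fun i => (hDG.comp hDw).clm_comp contDiff_const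
  have hf' : ∀ i x v a, fderiv ℝ (f i) x v a =
      fderiv ℝ (fderiv ℝ G) (fderiv ℝ w x) (fderiv ℝ (fderiv ℝ w) x v) ((c i).smulRight a) := by
    intro i x v a
    have h1 : HasFDerivAt (fun x => fderiv ℝ G (fderiv ℝ w x))
        ((fderiv ℝ (fderiv ℝ G) (fderiv ℝ w x)).comp (fderiv ℝ (fderiv ℝ w) x)) x :=
      ((hDG.differentiable (by norm_num)) _).hasFDerivAt.comp x
        ((hDw.differentiable (by norm_num)) x).hasFDerivAt
    have h2 := h1.clm_comp (hasFDerivAt_const (T i) x)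
    rw [show fderiv ℝ (f i) x = _ from h2.fderiv]
    simp [hT]
  have hsum : ∀ x, fderiv ℝ G (fderiv ℝ w x) (fderiv ℝ η x) =
      ∑ i, f i x (fderiv ℝ η x (b i)) := by
    intro x
    conv_lhs => rw [eq_sum_coord_smulRight b (fderiv ℝ η x)]
    simp [f, hT, c, map_sum]
  have hint1 : ∀ i, Integrable (fun x => f i x (fderiv ℝ η x (b i))) μ := fun i =>
    ((hf i).continuous.clm_apply (hDη.clm_apply continuous_const)).integrable_of_hasCompactSupport
      ((hηc.fderiv ℝ).mono (by
        intro x hx h0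
        apply hx
        simp [h0]))
  have hint2 : ∀ i, Integrable (fun x => fderiv ℝ (f i) x (b i) (η x)) μ := fun i =>
    ((((hf i).continuous_fderiv (by norm_num)).clm_apply continuous_const).clm_apply
      hη.continuous).integrable_of_hasCompactSupport
      (hηc.mono (by
        intro x hx h0
        apply hx
        simp [h0]))
  have hint3 : ∀ i, Integrable (fun x => f i x (η x)) μ := fun i =>
    ((hf i).continuous.clm_apply hη.continuous).integrable_of_hasCompactSupport
      (hηc.mono (by
        intro x hx h0
        apply hx
        simp [h0]))
  have hparts : ∀ i, ∫ x, f i x (fderiv ℝ η x (b i)) ∂μ =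
      -∫ x, fderiv ℝ (f i) x (b i) (η x) ∂μ := fun i =>
    integral_bilinear_fderiv_right_eq_neg_left_of_integrable
      (B := ContinuousLinearMap.id ℝ (F →L[ℝ] ℝ)) (hint2 i) (hint1 i) (hint3 i)
      (fun x _ => (hf i).differentiable (by norm_num) x)
      (fun x _ => hη.differentiable (by norm_num) x)
  simp_rw [hsum]
  rw [integral_finsetSum _ fun i _ => hint1 i]
  simp_rw [hparts]
  rw [Finset.sum_neg_distrib, ← integral_finsetSum _ fun i _ => hint2 i]
  simp_rw [hf']
  rw [neg_eq_zero]
  have : ∀ x, ∑ i, fderiv ℝ (fderiv ℝ G) (fderiv ℝ w x) (fderiv ℝ (fderiv ℝ w) x (b i))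
      ((c i).smulRight (η x)) = 0 := fun x =>
    hR.sum_fderiv_fderiv_eq_zero hG b _
      (fun y z => (hw.contDiffAt.isSymmSndFDerivAt (by simp)).eq y z) _
  simp [this]

/-- For a rank-one flat `G`, the derivative of `t ↦ ∫ G(∇u + t ∇η)` is zero for every `t`, not only
at `0`, so the integral takes the same value at `t = 0` and `t = 1`. -/
theorem RankOneFlat.setIntegral_add_eq {G : (E →L[ℝ] F) → ℝ} (hR : RankOneFlat G)
    (hG : ContDiff ℝ 2 G) {u η : E → F} (hu : ContDiff ℝ 2 u) (hη : ContDiff ℝ 2 η)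
    (hηc : HasCompactSupport η) {U : Set E} (hUm : MeasurableSet U) (hU : Bornology.IsBounded U)
    (hηU : tsupport η ⊆ U) (μ : Measure E) [μ.IsAddHaarMeasure] :
    ∫ x in U, G (fderiv ℝ (u + η) x) ∂μ = ∫ x in U, G (fderiv ℝ u x) ∂μ := by
  have hDη : Continuous (fderiv ℝ η) := hη.continuous_fderiv (by norm_num)
  have hDu : Continuous (fderiv ℝ u) := hu.continuous_fderiv (by norm_num)
  have hdu : Differentiable ℝ u := hu.differentiable (by norm_num)
  have hdη : Differentiable ℝ η := hη.differentiable (by norm_num)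
  have hder := hasDerivAt_setIntegral_line (hG.of_le (by norm_num)) hDu hDη hUm hU μ
  have hzero : ∀ t : ℝ, ∫ x in U, fderiv ℝ G (fderiv ℝ u x + t • fderiv ℝ η x) (fderiv ℝ η x) ∂μ
      = 0 := by
    intro t
    rw [setIntegral_eq_integral_of_forall_compl_eq_zero]
    · rw [← hR.integral_fderiv_eq_zero hG (hu.add (hη.const_smul t)) (hη.of_le (by norm_num)) hηc μ]
      refine integral_congr_ae (Eventually.of_forall fun x => ?_)
      have : fderiv ℝ (u + t • η) x = fderiv ℝ u x + t • fderiv ℝ η x := by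
        rw [fderiv_add (hdu x) ((hdη x).const_smul t), fderiv_const_smul (hdη x)]
      simp only
      rw [← this]; rfl
    · intro x hx
      have : fderiv ℝ η x = 0 := image_eq_zero_of_notMem_tsupport fun h =>
        hx (hηU (tsupport_fderiv_subset ℝ h))
      simp [this]
  have hconst := is_const_of_deriv_eq_zero (fun t => (hder t).differentiableAt)
    (fun t => by rw [(hder t).deriv, hzero]) 1 0
  simpa [fderiv_add (hdu _) (hdη _)] using hconst

/-! ### Second variation and oscillating test maps -/

/-- Testing `∫ D²G(A)(∇η, ∇η) = 0` with `χ a`, `(χ cos l) a` and `(χ sin l) a` isolates the value of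
the quadratic form at `l ⊗ a`, since the cross terms of the last two cancel. -/
theorem quadratic_smulRight_eq_zero_of_integral_eq_zero
    {B : (E →L[ℝ] F) →L[ℝ] (E →L[ℝ] F) →L[ℝ] ℝ} (hB : ∀ X Y, B X Y = B Y X) {Ω : Set E}
    (hΩo : IsOpen Ω) (hΩb : Bornology.IsBounded Ω) (hΩne : Ω.Nonempty) (μ : Measure E)
    [μ.IsAddHaarMeasure]
    (h : ∀ η : E → F, ContDiff ℝ ∞ η → HasCompactSupport η → tsupport η ⊆ Ω →
      ∫ x in Ω, B (fderiv ℝ η x) (fderiv ℝ η x) ∂μ = 0) (l : E →L[ℝ] ℝ) (a : F) :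
    B (l.smulRight a) (l.smulRight a) = 0 := by
  obtain ⟨x₀, hx₀⟩ := hΩne
  obtain ⟨χ, hχΩ, hχc, hχ, hχr, hχ1⟩ := exists_contDiff_tsupport_subset (n := ⊤) (hΩo.mem_nhds hx₀)
  have hχ0 : ∀ x, 0 ≤ χ x := fun x => (hχr ⟨x, rfl⟩).1
  have hχd : Differentiable ℝ χ := hχ.differentiable (by simp)
  have hχD : Continuous (fderiv ℝ χ) := hχ.continuous_fderiv (by simp)
  -- the hypothesis for the test map `(χ ψ) a`; it is used with `ψ = 1`, `cos l` and `sin l`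
  have hψ : ∀ ψ : E → ℝ, ContDiff ℝ ∞ ψ →
      ∫ x in Ω, B ((χ x • fderiv ℝ ψ x + ψ x • fderiv ℝ χ x).smulRight a)
        ((χ x • fderiv ℝ ψ x + ψ x • fderiv ℝ χ x).smulRight a) ∂μ = 0 := by
    intro ψ hψ
    have hsub : tsupport (fun x => (χ x * ψ x) • a) ⊆ tsupport χ := by
      refine closure_mono fun x hx h0 => hx ?_
      simp [h0]
    rw [← h (fun x => (χ x * ψ x) • a) ((hχ.mul hψ).smul contDiff_const)
      (hχc.of_isClosed_subset (isClosed_tsupport _) hsub) (hsub.trans hχΩ)]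
    refine integral_congr_ae (Eventually.of_forall fun x => ?_)
    have hd : HasFDerivAt (fun x => (χ x * ψ x) • a)
        ((χ x • fderiv ℝ ψ x + ψ x • fderiv ℝ χ x).smulRight a) x :=
      ((hχd x).hasFDerivAt.mul ((hψ.differentiable (by simp)) x).hasFDerivAt).smul_const a
    simp only [hd.fderiv]
  have h1 := hψ (fun _ => 1) contDiff_const
  have h2 := hψ (fun x => Real.cos (l x)) (Real.contDiff_cos.comp l.contDiff)
  have h3 := hψ (fun x => Real.sin (l x)) (Real.contDiff_sin.comp l.contDiff)
  have hcos : ∀ x, fderiv ℝ (fun x => Real.cos (l x)) x = -Real.sin (l x) • l := fun x =>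
    (l.hasFDerivAt.cos).fderiv
  have hsin : ∀ x, fderiv ℝ (fun x => Real.sin (l x)) x = Real.cos (l x) • l := fun x =>
    (l.hasFDerivAt.sin).fderiv
  simp only [hcos, hsin, fderiv_fun_const, Pi.zero_apply, smul_zero, zero_add, one_smul] at h1 h2 h3
  let S : (E →L[ℝ] ℝ) →L[ℝ] (E →L[ℝ] F) := (ContinuousLinearMap.smulRightL ℝ E F).flip a
  have hS : ∀ p : E →L[ℝ] ℝ, p.smulRight a = S p := fun p => rfl
  simp only [hS] at h1 h2 h3 ⊢
  have hint : ∀ p : E → E →L[ℝ] ℝ, Continuous p →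
      IntegrableOn (fun x => B (S (p x)) (S (p x))) Ω μ :=
    fun p hp => integrableOn_of_continuous_of_isBounded (by fun_prop) hΩb μ
  have hχcont := hχ.continuous
  have h4 : ∫ x in Ω, χ x ^ 2 * B (S l) (S l) ∂μ = 0 := by
    have e : ∀ x, χ x ^ 2 * B (S l) (S l) =
        B (S (χ x • -Real.sin (l x) • l + Real.cos (l x) • fderiv ℝ χ x))
          (S (χ x • -Real.sin (l x) • l + Real.cos (l x) • fderiv ℝ χ x)) +
        B (S (χ x • Real.cos (l x) • l + Real.sin (l x) • fderiv ℝ χ x))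
          (S (χ x • Real.cos (l x) • l + Real.sin (l x) • fderiv ℝ χ x)) -
        B (S (fderiv ℝ χ x)) (S (fderiv ℝ χ x)) := by
      intro x
      simp only [map_add, map_smul, add_apply, smul_apply,
        smul_eq_mul, hB (S (fderiv ℝ χ x)) (S l)]
      linear_combination (-(χ x ^ 2 * B (S l) (S l)) - B (S (fderiv ℝ χ x)) (S (fderiv ℝ χ x))) *
        Real.sin_sq_add_cos_sq (l x)
    simp only [e]
    rw [integral_sub, integral_add, h1, h2, h3]
    · simp
    · exact hint _ (by fun_prop)
    · exact hint _ (by fun_prop)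
    · exact (hint _ (by fun_prop)).add (hint _ (by fun_prop))
    · exact hint _ (by fun_prop)
  rw [integral_mul_const] at h4
  have hpos : 0 < ∫ x in Ω, χ x ^ 2 ∂μ := by
    rw [setIntegral_eq_integral_of_forall_compl_eq_zero]
    · refine Continuous.integral_pos_of_hasCompactSupport_nonneg_nonzero (x := x₀) (by fun_prop)
        (hχc.mono fun x hx h0 => hx ?_) (fun x => sq_nonneg _) ?_
      · simp [h0]
      · simp [hχ1]
    · intro x hx
      simp [image_eq_zero_of_notMem_tsupport fun h => hx (hχΩ h)]
  exact (mul_eq_zero.mp h4).resolve_left hpos.ne'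

/-- If the integral of `G` over `Ω` is constant under all small compactly supported perturbations of
the linear map `A`, its second variation `∫ D²G(A)(∇η, ∇η)` vanishes, and hence so does the Hessian
of `G` at `A` in rank-one directions. The admissible size of `t` may depend on `η`. -/
theorem fderiv_fderiv_smulRight_eq_zero_of_small_variations {G : (E →L[ℝ] F) → ℝ}
    (hG : ContDiff ℝ 2 G) {Ω : Set E} (hΩo : IsOpen Ω) (hΩb : Bornology.IsBounded Ω)
    (hΩne : Ω.Nonempty) (μ : Measure E) [μ.IsAddHaarMeasure] {A : E →L[ℝ] F}
    (h : ∀ η : E → F, ContDiff ℝ ∞ η → HasCompactSupport η → tsupport η ⊆ Ω →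
      ∀ᶠ t : ℝ in 𝓝 0, ∫ x in Ω, G (A + t • fderiv ℝ η x) ∂μ = ∫ _ in Ω, G A ∂μ)
    (l : E →L[ℝ] ℝ) (a : F) :
    fderiv ℝ (fderiv ℝ G) A (l.smulRight a) (l.smulRight a) = 0 := by
  refine quadratic_smulRight_eq_zero_of_integral_eq_zero (fderiv_fderiv_comm hG A) hΩo hΩb hΩne μ
    (fun η hη hηc hηΩ => ?_) l a
  have hDη : Continuous (fderiv ℝ η) := hη.continuous_fderiv (by simp)
  have hDG : ContDiff ℝ 1 (fderiv ℝ G) := hG.fderiv_right (by norm_num)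
  have h1 := hasDerivAt_setIntegral_line (hG.of_le (by norm_num))
    (continuous_const (y := A)) hDη hΩo.measurableSet hΩb μ
  have h2 : ∀ᶠ t : ℝ in 𝓝 0, ∫ x in Ω, fderiv ℝ G (A + t • fderiv ℝ η x) (fderiv ℝ η x) ∂μ = 0 := by
    filter_upwards [(h η hη hηc hηΩ).eventually_nhds] with t ht
    rw [← (h1 t).deriv]
    exact (EventuallyEq.deriv_eq ht).trans (deriv_const _ _)
  have h3 : HasDerivAt (fun t : ℝ => ∫ x in Ω, fderiv ℝ G (A + t • fderiv ℝ η x) (fderiv ℝ η x) ∂μ)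
      (∫ x in Ω, fderiv ℝ (fderiv ℝ G) (A + (0 : ℝ) • fderiv ℝ η x) (fderiv ℝ η x)
        (fderiv ℝ η x) ∂μ) 0 := by
    have hD2G : Continuous (fderiv ℝ (fderiv ℝ G)) := hDG.continuous_fderiv (by norm_num)
    have hDGc := hDG.continuous
    refine hasDerivAt_setIntegral_of_continuous
      (f := fun s x => fderiv ℝ G (A + s • fderiv ℝ η x) (fderiv ℝ η x))
      (f' := fun s x => fderiv ℝ (fderiv ℝ G) (A + s • fderiv ℝ η x) (fderiv ℝ η x)
        (fderiv ℝ η x)) (fun s => ?_) ?_ (fun s x => ?_) hΩo.measurableSet hΩb μ 0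
    · fun_prop
    · fun_prop
    · have h1 : HasDerivAt (fun s : ℝ => A + s • fderiv ℝ η x) (fderiv ℝ η x) s := by
        simpa using ((hasDerivAt_id s).smul_const (fderiv ℝ η x)).const_add A
      simpa using (((hDG.differentiable (by norm_num)) _).hasFDerivAt.comp_hasDerivAt s
        h1).clm_apply (hasDerivAt_const s (fderiv ℝ η x))
  have h4 := h3.deriv.symm.trans ((EventuallyEq.deriv_eq h2).trans (deriv_const _ _))
  simpa using h4

end Integral

section Diffeo

/-! ### Perturbations of the identity, cutoffs and invertible maps -/

variable {E : Type*} [NormedAddCommGroup E] [NormedSpace ℝ E]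

/-- `id + ζ` for a smooth `ζ` with `‖Dζ‖ ≤ 1/2` is a diffeomorphism of `E`. -/
theorem exists_contDiff_inverse_id_add [CompleteSpace E] {ζ : E → E} (hζ : ContDiff ℝ ∞ ζ)
    (hb : ∀ x, ‖fderiv ℝ ζ x‖ ≤ 1 / 2) :
    ∃ ψ : E → E, ContDiff ℝ ∞ ψ ∧ Function.LeftInverse ψ (fun x => x + ζ x) ∧
      Function.RightInverse ψ (fun x => x + ζ x) := by
  have hd : Differentiable ℝ ζ := hζ.differentiable (by simp)
  have hlip : LipschitzWith (1 / 2) ζ :=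
    lipschitzWith_of_nnnorm_fderiv_le hd fun x => by
      rw [← NNReal.coe_le_coe]; simpa using hb x
  have happ : ApproximatesLinearOn (fun x => x + ζ x)
      ((ContinuousLinearEquiv.refl ℝ E : E ≃L[ℝ] E) : E →L[ℝ] E) univ (1 / 2) := by
    intro x _ y _
    have := hlip.dist_le_mul x y
    rw [dist_eq_norm, dist_eq_norm] at this
    simpa [add_sub_add_comm] using this
  have hc : Subsingleton E ∨ (1 / 2 : NNReal) <
      ‖((ContinuousLinearEquiv.refl ℝ E).symm : E →L[ℝ] E)‖₊⁻¹ := by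
    rcases subsingleton_or_nontrivial E with h | h
    · exact Or.inl h
    · right
      have : ‖((ContinuousLinearEquiv.refl ℝ E).symm : E →L[ℝ] E)‖₊ = 1 := by
        change ‖ContinuousLinearMap.id ℝ E‖₊ = 1
        simp
      rw [this, ← NNReal.coe_lt_coe]; norm_num
  let H : E ≃ₜ E := happ.toHomeomorph _ hc
  have hunit : ∀ x, IsUnit (1 + fderiv ℝ ζ x) := by
    intro x
    have := isUnit_one_sub_of_norm_lt_one (x := -fderiv ℝ ζ x)
      (by rw [norm_neg]; exact (hb x).trans_lt (by norm_num))
    simpa using this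
  refine ⟨H.symm, ?_, fun x => H.symm_apply_apply x, fun x => H.apply_symm_apply x⟩
  refine H.contDiff_symm (f₀' := fun x => ContinuousLinearEquiv.unitsEquiv ℝ E (hunit x).unit)
    (fun x => ?_) (contDiff_id.add hζ)
  have h1 : HasFDerivAt (fun x => x + ζ x) (1 + fderiv ℝ ζ x) x :=
    (hasFDerivAt_id x).add (hd x).hasFDerivAt
  exact h1

theorem exists_contDiff_cutoff [FiniteDimensional ℝ E] {K Ω : Set E} (hK : IsCompact K)
    (hΩ : IsOpen Ω) (hKΩ : K ⊆ Ω) :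
    ∃ χ : E → ℝ, ContDiff ℝ ∞ χ ∧ HasCompactSupport χ ∧ tsupport χ ⊆ Ω ∧
      ∀ x ∈ K, ∀ᶠ y in 𝓝 x, χ y = 1 := by
  have := FiniteDimensional.proper ℝ E
  obtain ⟨t, htc, hKt, htΩ⟩ := exists_compact_between hK hΩ hKΩ
  obtain ⟨χ, h1, h0, -⟩ := exists_contMDiffMap_one_nhds_of_subset_interior (n := ⊤)
    (modelWithCornersSelf ℝ E) hK.isClosed hKt
  have hsub : tsupport χ ⊆ t := closure_minimal (fun x hx => by
    by_contra hxt
    exact hx (h0 x hxt)) htc.isClosed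
  exact ⟨χ, χ.contMDiff.contDiff, htc.of_isClosed_subset (isClosed_tsupport _) hsub,
    hsub.trans htΩ, fun x hx => (eventually_nhdsSet_iff_forall.mp h1) x hx⟩

/-- `A + r • id` is invertible for all small `r ≠ 0`, the spectrum of `-A` being finite. -/
theorem dense_isUnit_continuousLinearMap [FiniteDimensional ℝ E] :
    Dense {A : E →L[ℝ] E | IsUnit A} := by
  intro A
  have hfin : (spectrum ℝ (-A : E →L[ℝ] E)).Finite := by
    have h := Module.End.finite_spectrum ((-A : E →L[ℝ] E) : Module.End ℝ E)
    refine h.subset fun r hr => ?_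
    rw [spectrum.mem_iff] at hr ⊢
    contrapose! hr
    rw [ContinuousLinearMap.isUnit_iff_bijective]
    rw [Module.End.isUnit_iff] at hr
    exact hr
  have hev : ∀ᶠ r : ℝ in 𝓝[≠] 0, A + r • (1 : E →L[ℝ] E) ∈ {A : E →L[ℝ] E | IsUnit A} := by
    have : ∀ᶠ r : ℝ in 𝓝[≠] 0, r ∉ spectrum ℝ (-A : E →L[ℝ] E) := by
      have h1 := (hfin.subset sdiff_subset : (spectrum ℝ (-A : E →L[ℝ] E) \ {0}).Finite)
      have h2 := h1.isClosed.isOpen_compl.mem_nhds (x := (0 : ℝ)) (by simp)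
      filter_upwards [nhdsWithin_le_nhds h2, self_mem_nhdsWithin] with r hr hr0 hrs
      exact hr ⟨hrs, hr0⟩
    filter_upwards [this] with r hr
    rw [spectrum.notMem_iff, Algebra.algebraMap_eq_smul_one, sub_neg_eq_add, add_comm] at hr
    exact hr
  refine mem_closure_of_tendsto ?_ hev
  have : Continuous fun r : ℝ => A + r • (1 : E →L[ℝ] E) := by fun_prop
  simpa using (this.tendsto 0).mono_left nhdsWithin_le_nhds

end Diffeo

section Matrix

/-! ### Gradient matrices, outer and inner variations -/

variable {n : ℕ}

local notation "𝔼" => EuclideanSpace ℝ (Fin n)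

/-- The matrix of a linear self-map of `ℝⁿ` in the standard basis. -/
noncomputable def matrixCLM (n : ℕ) :
    (EuclideanSpace ℝ (Fin n) →L[ℝ] EuclideanSpace ℝ (Fin n)) →L[ℝ] Matrix (Fin n) (Fin n) ℝ :=
  LinearMap.toContinuousLinearMap
    { toFun := fun A => Matrix.of fun i j => A (EuclideanSpace.single j 1) i
      map_add' := fun A B => by ext; simp
      map_smul' := fun r A => by ext; simp }

/-- `L` as a function of the Fréchet derivative, a continuous linear map, rather than of the
gradient matrix. -/
noncomputable def lagrangian (L : Matrix (Fin n) (Fin n) ℝ → ℝ) (A : 𝔼 →L[ℝ] 𝔼) : ℝ :=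
  L (matrixCLM n A)

variable {L : Matrix (Fin n) (Fin n) ℝ → ℝ} {Ω : Set (EuclideanSpace ℝ (Fin n))}

theorem lagrangian_fderiv (u : 𝔼 → 𝔼) (x : 𝔼) : L (grad u x) = lagrangian L (fderiv ℝ u x) := rfl

theorem energy_eq_setIntegral_lagrangian (u : 𝔼 → 𝔼) (U : Set 𝔼) :
    energy L u U = ∫ x in U, lagrangian L (fderiv ℝ u x) := rfl

theorem contDiff_lagrangian (hL : ContDiff ℝ 2 L) : ContDiff ℝ 2 (lagrangian L) :=
  hL.comp (matrixCLM n).contDiff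

theorem isNullLagrangian_of_rankOneFlat (hL : ContDiff ℝ 2 L) (hR : RankOneFlat (lagrangian L)) :
    IsNullLagrangian L := fun _ hUo hUb _ _ hu hη hηc hηU =>
  hR.setIntegral_add_eq (contDiff_lagrangian hL) (hu.of_le (WithTop.coe_le_coe.2 le_top))
    (hη.of_le (WithTop.coe_le_coe.2 le_top)) hηc hUo.measurableSet hUb hηU volume

theorem fderiv_clm_add_smul (A : 𝔼 →L[ℝ] 𝔼) {η : 𝔼 → 𝔼} (hη : Differentiable ℝ η) (t : ℝ)
    (x : 𝔼) : fderiv ℝ (fun x => A x + t • η x) x = A + t • fderiv ℝ η x :=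
  (A.hasFDerivAt.add ((hη x).hasFDerivAt.const_smul t)).fderiv

theorem tsupport_const_smul_subset (t : ℝ) (η : 𝔼 → 𝔼) :
    tsupport (fun x => t • η x) ⊆ tsupport η :=
  closure_mono fun x hx h0 => hx (by simp [h0])

theorem IsNullLagrangian.rankOneFlat (hL : ContDiff ℝ 2 L) (h : IsNullLagrangian L)
    (hΩo : IsOpen Ω) (hΩb : Bornology.IsBounded Ω) (hΩne : Ω.Nonempty) :
    RankOneFlat (lagrangian L) := by
  intro A l a
  refine fderiv_fderiv_smulRight_eq_zero_of_small_variations (contDiff_lagrangian hL) hΩo hΩb hΩne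
    volume (fun η hη hηc hηΩ => Eventually.of_forall fun t => ?_) l a
  have hsub := tsupport_const_smul_subset t η
  have h1 := h Ω hΩo hΩb A (fun x => t • η x) A.contDiff (hη.const_smul t)
    (hηc.of_isClosed_subset (isClosed_tsupport _) hsub) (hsub.trans hηΩ)
  simp only [energy_eq_setIntegral_lagrangian, ContinuousLinearMap.fderiv] at h1
  rw [← h1]
  refine integral_congr_ae (Eventually.of_forall fun x => ?_)
  exact congrArg (lagrangian L) (fderiv_clm_add_smul A (hη.differentiable (by simp)) t x).symm

theorem eventually_id_add_mem_diff0 {η : 𝔼 → 𝔼} (hη : ContDiff ℝ ∞ η)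
    (hηc : HasCompactSupport η) (hηΩ : tsupport η ⊆ Ω) :
    ∀ᶠ t : ℝ in 𝓝 0, (fun x => x + t • η x) ∈ Diff0 Ω := by
  obtain ⟨C, hC⟩ := (hηc.fderiv ℝ).exists_bound_of_continuous (hη.continuous_fderiv (by simp))
  have hlim : Tendsto (fun t : ℝ => ‖t‖ * C) (𝓝 0) (𝓝 0) := by
    have : Continuous fun t : ℝ => ‖t‖ * C := by fun_prop
    simpa using this.tendsto 0
  filter_upwards [hlim.eventually (ge_mem_nhds (by norm_num : (0 : ℝ) < 1 / 2))] with t ht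
  have hsub := tsupport_const_smul_subset t η
  refine ⟨contDiff_id.add (hη.const_smul t), ?_, ?_⟩
  · refine exists_contDiff_inverse_id_add (ζ := fun x => t • η x) (hη.const_smul t) fun x => ?_
    have hd : fderiv ℝ (fun x => t • η x) x = t • fderiv ℝ η x :=
      ((hη.differentiable (by simp) x).hasFDerivAt.const_smul t).fderiv
    rw [hd, norm_smul]
    exact (mul_le_mul_of_nonneg_left (hC x) (norm_nonneg t)).trans ht
  · simp only [add_sub_cancel_left]
    exact ⟨hηc.of_isClosed_subset (isClosed_tsupport _) hsub, hsub.trans hηΩ⟩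

/-- At an invertible `A`, every small perturbation `A + tη` is the inner variation
`A ∘ (id + t A⁻¹η)`, so inner invariance gives the second variation there; the invertible maps
are dense. -/
theorem IsInnerInvariant.rankOneFlat (hL : ContDiff ℝ 2 L) (h : IsInnerInvariant L Ω)
    (hΩo : IsOpen Ω) (hΩb : Bornology.IsBounded Ω) (hΩne : Ω.Nonempty) :
    RankOneFlat (lagrangian L) := by
  refine RankOneFlat.of_dense (contDiff_lagrangian hL) dense_isUnit_continuousLinearMap
    fun A hA l a => ?_
  refine fderiv_fderiv_smulRight_eq_zero_of_small_variations (contDiff_lagrangian hL) hΩo hΩb hΩne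
    volume (fun η hη hηc hηΩ => ?_) l a
  obtain ⟨e, rfl⟩ := hA
  let B : 𝔼 →L[ℝ] 𝔼 := (e⁻¹ : (𝔼 →L[ℝ] 𝔼)ˣ)
  have hB : ∀ y, (e : 𝔼 →L[ℝ] 𝔼) (B y) = y := fun y =>
    congrArg (fun T : 𝔼 →L[ℝ] 𝔼 => T y) e.mul_inv
  have hsub : tsupport (fun x => B (η x)) ⊆ tsupport η :=
    closure_mono fun x hx h0 => hx (by simp [h0])
  filter_upwards [eventually_id_add_mem_diff0 (B.contDiff.comp hη)
    (hηc.of_isClosed_subset (isClosed_tsupport _) hsub) (hsub.trans hηΩ)] with t ht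
  have h1 := (h (e : 𝔼 →L[ℝ] 𝔼) (ContinuousLinearMap.contDiff _).contDiffOn (by
    simp only [lagrangian_fderiv, ContinuousLinearMap.fderiv]
    exact integrableOn_of_continuous_of_isBounded continuous_const hΩb volume) _ ht).2
  simp only [energy_eq_setIntegral_lagrangian, ContinuousLinearMap.fderiv] at h1
  rw [← h1]
  refine integral_congr_ae (Eventually.of_forall fun x => ?_)
  have hcomp : (e : 𝔼 →L[ℝ] 𝔼) ∘ (fun x => x + t • (⇑B ∘ η) x) =
      fun x => (e : 𝔼 →L[ℝ] 𝔼) x + t • η x := by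
    ext1 x; simp [hB]
  simp only [hcomp]
  rw [fderiv_clm_add_smul _ (hη.differentiable (by simp)) t x]

/-- A point outside `Ω` is fixed, so by injectivity no point of `Ω` is sent outside `Ω`. -/
theorem mapsTo_of_mem_diff0 {φ : 𝔼 → 𝔼} (hφ : φ ∈ Diff0 Ω) : MapsTo φ Ω Ω := by
  obtain ⟨-, ⟨ψ, -, hl, -⟩, -, hs⟩ := hφ
  intro x hx
  by_contra h
  have h1 : φ (φ x) - φ x = 0 :=
    image_eq_zero_of_notMem_tsupport (f := fun x => φ x - x) fun h' => h (hs h')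
  exact h (by rwa [hl.injective (sub_eq_zero.mp h1)])

/-- The inner variation `u ∘ φ` differs from `u` by `η = u ∘ φ - u`, with compact support in `Ω`.
As `u` is only regular on `Ω`, it is replaced by `v = χ u`, with a cutoff `χ` equal to `1` near the
support `K` of `φ - id`. Then `L(∇(u ∘ φ)) - L(∇u) = L(∇(v + η)) - L(∇v)` everywhere: near `K` the
maps agree, and off `K` both sides are zero. -/
theorem isInnerInvariant_of_rankOneFlat (hL : ContDiff ℝ 2 L) (hR : RankOneFlat (lagrangian L))
    (hΩo : IsOpen Ω) (hΩb : Bornology.IsBounded Ω) : IsInnerInvariant L Ω := by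
  intro u hu hint φ hφ
  have hmaps := mapsTo_of_mem_diff0 hφ
  obtain ⟨hφs, -, hKc, hKΩ⟩ := hφ
  set K := tsupport fun x => φ x - x
  have hG := contDiff_lagrangian hL
  obtain ⟨χ, hχ, hχc, hχΩ, hχ1⟩ := exists_contDiff_cutoff hKc hΩo hKΩ
  have huAt : ∀ x ∈ Ω, ContDiffAt ℝ 2 u x := fun x hx =>
    (hu.contDiffAt (hΩo.mem_nhds hx)).of_le (by norm_num)
  have hoff : ∀ x ∉ K, u ∘ φ =ᶠ[𝓝 x] u := fun x hx => by
    filter_upwards [notMem_tsupport_iff_eventuallyEq.mp hx] with y hy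
    exact congrArg u (sub_eq_zero.mp hy)
  let v : 𝔼 → 𝔼 := fun x => χ x • u x
  let η : 𝔼 → 𝔼 := u ∘ φ - u
  have hv : ContDiff ℝ 2 v := contDiff_iff_contDiffAt.mpr fun x => by
    by_cases hx : x ∈ tsupport χ
    · exact (hχ.contDiffAt.of_le (WithTop.coe_le_coe.2 le_top)).smul (huAt x (hχΩ hx))
    · refine (contDiffAt_const (c := (0 : 𝔼))).congr_of_eventuallyEq ?_
      filter_upwards [notMem_tsupport_iff_eventuallyEq.mp hx] with y hy
      simp [v, hy]
  have hη0 : ∀ x ∉ K, η =ᶠ[𝓝 x] 0 := fun x hx => by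
    filter_upwards [hoff x hx] with y hy
    exact sub_eq_zero.mpr hy
  have hη : ContDiff ℝ 2 η := contDiff_iff_contDiffAt.mpr fun x => by
    by_cases hx : x ∈ K
    · exact ((huAt (φ x) (hmaps (hKΩ hx))).comp x
        (hφs.contDiffAt.of_le (WithTop.coe_le_coe.2 le_top))).sub (huAt x (hKΩ hx))
    · exact (contDiffAt_const (c := (0 : 𝔼))).congr_of_eventuallyEq (hη0 x hx)
  have hηK : tsupport η ⊆ K := closure_minimal (fun x hx => by
    by_contra hxK
    exact hx (hη0 x hxK).self_of_nhds) (isClosed_tsupport _)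
  have hηc : HasCompactSupport η := hKc.of_isClosed_subset (isClosed_tsupport _) hηK
  let g : 𝔼 → ℝ := fun x => lagrangian L (fderiv ℝ (v + η) x) - lagrangian L (fderiv ℝ v x)
  have hc1 : Continuous fun x => lagrangian L (fderiv ℝ (v + η) x) :=
    hG.continuous.comp ((hv.add hη).continuous_fderiv (by norm_num))
  have hc2 : Continuous fun x => lagrangian L (fderiv ℝ v x) :=
    hG.continuous.comp (hv.continuous_fderiv (by norm_num))
  have hi1 := integrableOn_of_continuous_of_isBounded hc1 hΩb volume
  have hi2 := integrableOn_of_continuous_of_isBounded hc2 hΩb volume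
  have hgzero : ∫ x in Ω, g x = 0 := by
    rw [integral_sub hi1 hi2, hR.setIntegral_add_eq hG hv hη hηc hΩo.measurableSet hΩb
      (hηK.trans hKΩ) volume, sub_self]
  have heq : ∀ x, L (grad (u ∘ φ) x) = L (grad u x) + g x := by
    intro x
    simp only [lagrangian_fderiv, g]
    by_cases hx : x ∈ K
    · have hvu : v =ᶠ[𝓝 x] u := by
        filter_upwards [hχ1 x hx] with y hy
        simp [v, hy]
      have hwu : v + η =ᶠ[𝓝 x] u ∘ φ := by
        filter_upwards [hvu] with y hy
        simp [η, hy]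
      rw [hvu.fderiv_eq, hwu.fderiv_eq]; ring
    · have hwv : v + η =ᶠ[𝓝 x] v := by
        filter_upwards [hη0 x hx] with y hy
        simp [hy]
      rw [hwv.fderiv_eq, (hoff x hx).fderiv_eq]; ring
  have hgi : IntegrableOn g Ω := hi1.sub hi2
  refine ⟨?_, ?_⟩
  · simp only [heq]
    exact hint.add hgi
  · simp only [energy, heq]
    rw [integral_add hint hgi, hgzero, add_zero]

end Matrix

end NullLagrangian

theorem proposition1p2 {n : ℕ} (Ω : Set (EuclideanSpace ℝ (Fin n))) (hΩo : IsOpen Ω)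
    (hΩb : Bornology.IsBounded Ω) (hΩne : Ω.Nonempty)
    (L : Matrix (Fin n) (Fin n) ℝ → ℝ) (hL : ContDiff ℝ 2 L) :
    NullLagrangian.IsInnerInvariant L Ω ↔ NullLagrangian.IsNullLagrangian L :=
  ⟨fun h => NullLagrangian.isNullLagrangian_of_rankOneFlat hL (h.rankOneFlat hL hΩo hΩb hΩne),
    fun h => NullLagrangian.isInnerInvariant_of_rankOneFlat hL (h.rankOneFlat hL hΩo hΩb hΩne)
      hΩo hΩb⟩
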